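/- Let $\mathcal H$ be a complex Hilbert space, let $A\subset\mathbb B(\mathcal H)$ be a von Neumann algebra (containing the identity operator) and let $\mathcal U(A)$ be its unitary group. A state $\varphi$ on $\mathbb B(\mathcal H)$ is called $A$-central if $\varphi(aT)=\varphi(Ta)$ for all $a\in A$ and $T\in\mathbb B(\mathcal H)$. Suppose that $A$ is finite (every isometry in $A$ is unitary) and amenable, the latter in the sense that there is an $A$-central state on $\mathbb B(\mathcal H)$. Let $\bar{\mathcal H}$ be the complex conjugate Hilbert space of $\mathcal H$, with $\bar{\xi}\in\bar{\mathcal H}$ the vector corresponding to $\xi\in\mathcal H$, and for $y\in\mathbb B(\mathcal H)$ let $\bar y\in\mathbb B(\bar{\mathcal H})$ be the operator $\bar y\,\bar\xi=\overline{y\xi}$. Let $x\in\mathbb B(\mathcal H)$ be such that the norm-closed convex hull of $$\{(u\otimes\bar u)(x\otimes\bar x)(u\otimes\bar u)^* : u\in\mathcal U(A)\}$$ in $\mathbb B(\mathcal H\otimes\bar{\mathcal H})$ (Hilbert space tensor product) contains $0$. Then $\varphi(x^*a)=0$ for every $a\in A$ and every $A$-central state $\varphi$ on $\mathbb B(\mathcal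 H)$. -/

import Mathlib

open scoped TensorProduct ComplexOrder InnerProductSpace

noncomputable section

/-- The complex conjugate `H̄` of a complex Hilbert space `H`: the same additive group and norm,
with the scalar action and the inner product conjugated. -/
def ConjHilbert (H : Type*) : Type _ := H

namespace ConjHilbert

instance instNormedAddCommGroup (H : Type*) [NormedAddCommGroup H] :
    NormedAddCommGroup (ConjHilbert H) :=
  inferInstanceAs (NormedAddCommGroup H)

instance instCompleteSpace (H : Type*) [NormedAddCommGroup H] [CompleteSpace H] :
    CompleteSpace (ConjHilbert H) :=
  inferInstanceAs (CompleteSpace H)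

/-- The canonical additive bijection `ξ ↦ ξ̄` from `H` to `H̄`. -/
def barAddEquiv (H : Type*) [NormedAddCommGroup H] : H ≃+ ConjHilbert H :=
  AddEquiv.refl H

/-- Scalars act on `H̄` by `c • ξ̄ = (conj c • ξ)‾`. -/
instance instModule (H : Type*) [NormedAddCommGroup H] [InnerProductSpace ℂ H] :
    Module ℂ (ConjHilbert H) where
  smul c ξ := barAddEquiv H (starRingEnd ℂ c • (barAddEquiv H).symm ξ)
  one_smul ξ := by
    change barAddEquiv H (starRingEnd ℂ 1 • (barAddEquiv H).symm ξ) = ξ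
    simp
  mul_smul c d ξ := by
    change barAddEquiv H (starRingEnd ℂ (c * d) • (barAddEquiv H).symm ξ) =
      barAddEquiv H (starRingEnd ℂ c • (barAddEquiv H).symm
        (barAddEquiv H (starRingEnd ℂ d • (barAddEquiv H).symm ξ)))
    simp [mul_smul]
  smul_zero c := by
    change barAddEquiv H (starRingEnd ℂ c • (barAddEquiv H).symm 0) = 0
    simp
  smul_add c ξ η := by
    change barAddEquiv H (starRingEnd ℂ c • (barAddEquiv H).symm (ξ + η)) =
      barAddEquiv H (starRingEnd ℂ c • (barAddEquiv H).symm ξ) +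
        barAddEquiv H (starRingEnd ℂ c • (barAddEquiv H).symm η)
    simp [smul_add]
  add_smul c d ξ := by
    change barAddEquiv H (starRingEnd ℂ (c + d) • (barAddEquiv H).symm ξ) =
      barAddEquiv H (starRingEnd ℂ c • (barAddEquiv H).symm ξ) +
        barAddEquiv H (starRingEnd ℂ d • (barAddEquiv H).symm ξ)
    simp [add_smul]
  zero_smul ξ := by
    change barAddEquiv H (starRingEnd ℂ 0 • (barAddEquiv H).symm ξ) = 0
    simp

theorem smul_def {H : Type*} [NormedAddCommGroup H] [InnerProductSpace ℂ H]
    (c : ℂ) (ξ : ConjHilbert H) :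
    c • ξ = barAddEquiv H (starRingEnd ℂ c • (barAddEquiv H).symm ξ) := rfl

theorem norm_bar {H : Type*} [NormedAddCommGroup H] (ξ : H) : ‖barAddEquiv H ξ‖ = ‖ξ‖ := rfl

theorem norm_bar_symm {H : Type*} [NormedAddCommGroup H] (ξ : ConjHilbert H) :
    ‖(barAddEquiv H).symm ξ‖ = ‖ξ‖ := rfl

/-- The inner product of `H̄` is `⟪ξ̄, η̄⟫ = ⟪η, ξ⟫`. -/
instance instInnerProductSpace (H : Type*) [NormedAddCommGroup H] [InnerProductSpace ℂ H] :
    InnerProductSpace ℂ (ConjHilbert H) where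
  norm_smul_le c ξ := by
    rw [smul_def, norm_bar, norm_smul, norm_bar_symm]
    simp
  inner ξ η := ⟪(barAddEquiv H).symm η, (barAddEquiv H).symm ξ⟫_ℂ
  norm_sq_eq_re_inner ξ := by
    rw [← norm_bar_symm ξ]
    exact norm_sq_eq_re_inner (𝕜 := ℂ) ((barAddEquiv H).symm ξ)
  conj_inner_symm ξ η := inner_conj_symm _ _
  add_left ξ η ζ := by
    rw [map_add]
    exact inner_add_right _ _ _
  smul_left ξ η c := by
    rw [smul_def, AddEquiv.symm_apply_apply]
    exact inner_smul_right _ _ _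

/-- The canonical conjugate-linear isometric bijection `ξ ↦ ξ̄` from `H` onto `H̄`. -/
def bar (H : Type*) [NormedAddCommGroup H] [InnerProductSpace ℂ H] :
    H ≃ₗᵢ⋆[ℂ] ConjHilbert H where
  toFun := barAddEquiv H
  invFun := (barAddEquiv H).symm
  left_inv := (barAddEquiv H).left_inv
  right_inv := (barAddEquiv H).right_inv
  map_add' := map_add (barAddEquiv H)
  map_smul' c ξ := by simp [smul_def]
  norm_map' := norm_bar

theorem inner_bar_bar {H : Type*} [NormedAddCommGroup H] [InnerProductSpace ℂ H] (ξ η : H) :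
    ⟪bar H ξ, bar H η⟫_ℂ = ⟪η, ξ⟫_ℂ := rfl

/-- The conjugate operator `x̄` on `H̄` of `x ∈ B(H)`: it maps `ξ̄` to the conjugate of `x ξ`. -/
def conjOp {H : Type*} [NormedAddCommGroup H] [InnerProductSpace ℂ H] (x : H →L[ℂ] H) :
    ConjHilbert H →L[ℂ] ConjHilbert H :=
  ((bar H).toContinuousLinearEquiv : H →L⋆[ℂ] ConjHilbert H) ∘SL
    (x ∘SL ((bar H).symm.toContinuousLinearEquiv : ConjHilbert H →L⋆[ℂ] H))

theorem conjOp_bar {H : Type*} [NormedAddCommGroup H] [InnerProductSpace ℂ H] (x : H →L[ℂ] H)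
    (ξ : H) : conjOp x (bar H ξ) = bar H (x ξ) := rfl

end ConjHilbert

/-- The Hilbert space tensor product: the completion of the algebraic tensor product in the inner
product determined by `⟪ξ ⊗ η, ξ' ⊗ η'⟫ = ⟪ξ, ξ'⟫ ⟪η, η'⟫`. -/
abbrev HilbertTensor (H K : Type*) [NormedAddCommGroup H] [InnerProductSpace ℂ H]
    [NormedAddCommGroup K] [InnerProductSpace ℂ K] : Type _ :=
  UniformSpace.Completion (H ⊗[ℂ] K)

/-- The tensor product `x ⊗ y` of bounded operators, acting on the Hilbert space tensor product. -/
def opTensor {H K : Type*} [NormedAddCommGroup H] [InnerProductSpace ℂ H]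
    [NormedAddCommGroup K] [InnerProductSpace ℂ K] (x : H →L[ℂ] H) (y : K →L[ℂ] K) :
    HilbertTensor H K →L[ℂ] HilbertTensor H K :=
  (TensorProduct.mapL x y).completion

theorem opTensor_tmul {H K : Type*} [NormedAddCommGroup H] [InnerProductSpace ℂ H]
    [NormedAddCommGroup K] [InnerProductSpace ℂ K] (x : H →L[ℂ] H) (y : K →L[ℂ] K)
    (ξ : H) (η : K) :
    opTensor x y ((ξ ⊗ₜ[ℂ] η : H ⊗[ℂ] K) : HilbertTensor H K) =
      ((x ξ ⊗ₜ[ℂ] y η : H ⊗[ℂ] K) : HilbertTensor H K) := by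
  simp [opTensor]

namespace VonNeumannAlgebra

/-- A von Neumann algebra is finite if each of its isometries is unitary. -/
def IsFinite {H : Type*} [NormedAddCommGroup H] [InnerProductSpace ℂ H] [CompleteSpace H]
    (A : VonNeumannAlgebra H) : Prop :=
  ∀ v ∈ A, star v * v = 1 → v * star v = 1

/-- A state on `B(H)` (a positive linear functional with value `1` at the identity) which is
`A`-central: `φ (a T) = φ (T a)` for all `a ∈ A` and all `T ∈ B(H)`. -/
structure IsCentralState {H : Type*} [NormedAddCommGroup H] [InnerProductSpace ℂ H]
    [CompleteSpace H] (A : VonNeumannAlgebra H) (φ : (H →L[ℂ] H) →ₚ[ℂ] ℂ) : Prop where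
  map_one : φ 1 = 1
  map_mul_comm : ∀ a ∈ A, ∀ T : H →L[ℂ] H, φ (a * T) = φ (T * a)

/-- Amenability of a (finite) von Neumann algebra `A` acting on `H`, expressed through central
states: there is an `A`-central state on `B(H)`. -/
def IsAmenable {H : Type*} [NormedAddCommGroup H] [InnerProductSpace ℂ H] [CompleteSpace H]
    (A : VonNeumannAlgebra H) : Prop :=
  ∃ φ : (H →L[ℂ] H) →ₚ[ℂ] ℂ, A.IsCentralState φ

/-- The set of all `(u ⊗ ū)(x ⊗ x̄)(u ⊗ ū)*` in `B(H ⊗ H̄)`, for `u` a unitary element of `A`. -/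
def conjugationOrbit {H : Type*} [NormedAddCommGroup H] [InnerProductSpace ℂ H] [CompleteSpace H]
    (A : VonNeumannAlgebra H) (x : H →L[ℂ] H) :
    Set (HilbertTensor H (ConjHilbert H) →L[ℂ] HilbertTensor H (ConjHilbert H)) :=
  {T | ∃ u ∈ A, u ∈ unitary (H →L[ℂ] H) ∧
    T = opTensor u (ConjHilbert.conjOp u) * opTensor x (ConjHilbert.conjOp x) *
      star (opTensor u (ConjHilbert.conjOp u))}

end VonNeumannAlgebra

end

/-! A central state is invariant under conjugation by the unitaries of `A`. By Day's convexity trick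
it is approximated, on one prescribed operator, by finite rank densities that are almost invariant
in norm under finitely many such unitaries (`exists_almost_invariant_vectors`). A density with
eigenvectors `e k` and eigenvalues `s k ^ 2` has as square root the Hilbert–Schmidt operator that
corresponds to the unit vector `z = ∑ s k • e k ⊗ ē k`. The Powers–Størmer inequality
(`powers_stormer`) turns almost invariance of the density into almost invariance of `z` under `v ⊗
v̄`.

Choose a convex combination of conjugates of `X = x ⊗ x̄` of small norm, and let `z` be almost fixed
by the unitaries occurring in it and by one more unitary `w` of `A`. Then `⟪z, X z⟫` is close to the
value of the combination at `z`, hence to `0`, and so is `⟪z, X (w ⊗ w̄) z⟫`. By Cauchy–Schwarz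
(`norm_sum_inner_sq_le`) the latter dominates the squared modulus of the density's value at `x * w`,
which approximates `φ (x * w)`. Hence `φ (x * w) = 0`. Unitaries span `A`, and taking adjoints gives
the claim for `star x`. -/

noncomputable section

/-! ### Finite rank functionals, their dual, and states -/

section VectorFunctionals

variable {H : Type*} [NormedAddCommGroup H] [InnerProductSpace ℂ H]

/-- The functional `T ↦ ⟪ξ, T η⟫` on `B(H)`. -/
def vectorFunctional (ξ η : H) : (H →L[ℂ] H) →L[ℂ] ℂ :=
  innerSL ℂ ξ ∘L ContinuousLinearMap.apply ℂ H η

@[simp]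
theorem vectorFunctional_apply (ξ η : H) (T : H →L[ℂ] H) :
    vectorFunctional ξ η T = ⟪ξ, T η⟫_ℂ := rfl

theorem norm_vectorFunctional_le (ξ η : H) : ‖vectorFunctional ξ η‖ ≤ ‖ξ‖ * ‖η‖ := by
  refine ContinuousLinearMap.opNorm_le_bound _ (by positivity) fun T => ?_
  calc ‖⟪ξ, T η⟫_ℂ‖ ≤ ‖ξ‖ * ‖T η‖ := norm_inner_le_norm _ _
    _ ≤ ‖ξ‖ * (‖T‖ * ‖η‖) := by gcongr; exact T.le_opNorm η
    _ = ‖ξ‖ * ‖η‖ * ‖T‖ := by ring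

/-- The span of a family in a complex normed space. -/
def spanRange {D κ : Type*} [NormedAddCommGroup D] [NormedSpace ℂ D] (f : κ → D) :
    Submodule ℂ D :=
  Submodule.span ℂ (Set.range f)

variable (H) in
/-- The finite rank functionals on `B(H)`, normed as functionals on `B(H)`. -/
def FiniteRankFunctional : Type _ :=
  spanRange fun p : H × H => vectorFunctional p.1 p.2

namespace FiniteRankFunctional

instance : NormedAddCommGroup (FiniteRankFunctional H) :=
  Submodule.normedAddCommGroup (spanRange fun p : H × H => vectorFunctional p.1 p.2)

instance : NormedSpace ℂ (FiniteRankFunctional H) :=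
  Submodule.normedSpace (spanRange fun p : H × H => vectorFunctional p.1 p.2)

variable (H) in
/-- The inclusion of the finite rank functionals in the dual of `B(H)`. -/
def toDual : FiniteRankFunctional H →ₗᵢ[ℂ] ((H →L[ℂ] H) →L[ℂ] ℂ) :=
  (spanRange fun p : H × H => vectorFunctional p.1 p.2).subtypeₗᵢ

/-- The vector functional of `ξ` and `η` as a finite rank functional. -/
def vector (ξ η : H) : FiniteRankFunctional H :=
  ⟨vectorFunctional ξ η, Submodule.subset_span ⟨(ξ, η), rfl⟩⟩

@[simp]
theorem toDual_vector (ξ η : H) : toDual H (vector ξ η) = vectorFunctional ξ η := rfl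

theorem span_range_vector :
    Submodule.span ℂ (Set.range fun p : H × H => vector p.1 p.2) = ⊤ := by
  refine Submodule.map_injective_of_injective (f := (toDual H).toLinearMap)
    (toDual H).injective ?_
  rw [Submodule.map_span, ← Set.range_comp, Submodule.map_top]
  exact (Submodule.range_subtype
    (spanRange fun p : H × H => vectorFunctional p.1 p.2)).symm

end FiniteRankFunctional

open FiniteRankFunctional

variable [CompleteSpace H]

/-- Every bounded functional on the finite rank functionals is evaluation at an operator. -/
theorem exists_eval_of_dual_finiteRankFunctional (ℓ : FiniteRankFunctional H →L[ℂ] ℂ) :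
    ∃ V : H →L[ℂ] H, ∀ ω, ℓ ω = toDual H ω V := by
  have hb : ∀ ξ η : H, ‖ℓ (vector ξ η)‖ ≤ ‖ℓ‖ * ‖ξ‖ * ‖η‖ := fun ξ η => by
    refine (ℓ.le_opNorm _).trans ?_
    rw [mul_assoc]
    exact mul_le_mul_of_nonneg_left ((norm_vectorFunctional_le ξ η :)) (norm_nonneg _)
  let B : H →L⋆[ℂ] H →L[ℂ] ℂ := LinearMap.mkContinuous₂
    (LinearMap.mk₂'ₛₗ (starRingEnd ℂ) (RingHom.id ℂ)
      (fun ξ η => ℓ (vector ξ η))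
      (fun ξ ξ' η => by
        rw [← map_add]; congr 1; apply (toDual H).injective; ext T; simp)
      (fun c ξ η => by
        rw [← map_smul]; congr 1; apply (toDual H).injective; ext T; simp [mul_comm])
      (fun ξ η η' => by
        rw [← map_add]; congr 1; apply (toDual H).injective; ext T; simp)
      (fun c ξ η => by
        rw [RingHom.id_apply, ← map_smul]; congr 1; apply (toDual H).injective; ext T; simp))
    ‖ℓ‖ hb
  -- The operator representing `B` acts in the first slot of the inner product; its adjoint acts in
  -- the second.
  let V := star (InnerProductSpace.continuousLinearMapOfBilin B)
  have hV : ℓ.toLinearMap =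
      (ContinuousLinearMap.apply ℂ ℂ V).toLinearMap ∘ₗ (toDual H).toLinearMap := by
    refine LinearMap.ext_on_range span_range_vector fun p => ?_
    obtain ⟨ξ, η⟩ := p
    change ℓ (vector ξ η) = ⟪ξ, star (InnerProductSpace.continuousLinearMapOfBilin B) η⟫_ℂ
    rw [ContinuousLinearMap.star_eq_adjoint, ContinuousLinearMap.adjoint_inner_right,
      InnerProductSpace.continuousLinearMapOfBilin_apply]
    rfl
  exact ⟨V, fun ω => LinearMap.congr_fun hV ω⟩

/-- A state dominates any lower bound of the numerical range. -/
theorem le_re_state_of_forall_le (φ : (H →L[ℂ] H) →ₚ[ℂ] ℂ) (hφ : φ 1 = 1) (W : H →L[ℂ] H)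
    (c : ℝ) (h : ∀ ξ : H, ‖ξ‖ = 1 → c ≤ (⟪ξ, W ξ⟫_ℂ).re) : c ≤ (φ W).re := by
  have h' : ∀ ξ : H, c * ‖ξ‖ ^ 2 ≤ (⟪ξ, W ξ⟫_ℂ).re := fun ξ => by
    rcases eq_or_ne ξ 0 with rfl | hξ
    · simp
    have h0 : ‖ξ‖ ≠ 0 := norm_ne_zero_iff.2 hξ
    have := h ((‖ξ‖⁻¹ : ℂ) • ξ) (by simp [norm_smul, h0])
    rw [map_smul, inner_smul_left, inner_smul_right, ← mul_assoc] at this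
    have e : (starRingEnd ℂ) (‖ξ‖⁻¹ : ℂ) * (‖ξ‖⁻¹ : ℂ) = ((‖ξ‖⁻¹ * ‖ξ‖⁻¹ : ℝ) : ℂ) := by
      simp
    rw [e, Complex.re_ofReal_mul] at this
    have := mul_le_mul_of_nonneg_right this (sq_nonneg ‖ξ‖)
    field_simp at this
    linarith
  -- Positivity is applied to twice the real part of `W - c`, since `φ (W + star W)` is twice the
  -- real part of `φ W`.
  have hpos : (0 : H →L[ℂ] H) ≤ W + star W - ((2 * c : ℝ) : ℂ) • 1 := by
    rw [ContinuousLinearMap.nonneg_iff_isPositive, ContinuousLinearMap.isPositive_def']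
    refine ⟨?_, fun ξ => ?_⟩
    · rw [IsSelfAdjoint]
      simp only [star_sub, star_add, star_star, star_smul, star_one]
      rw [add_comm]; simp
    · have hs : ⟪ξ, (star W) ξ⟫_ℂ = (starRingEnd ℂ) ⟪ξ, W ξ⟫_ℂ := by
        rw [ContinuousLinearMap.star_eq_adjoint, ContinuousLinearMap.adjoint_inner_right,
          inner_conj_symm]
      rw [ContinuousLinearMap.reApplyInnerSelf_apply, inner_re_symm]
      simp only [sub_apply, add_apply,
        smul_apply, one_apply_eq_self, inner_sub_right,
        inner_add_right, inner_smul_right, hs, inner_self_eq_norm_sq_to_K]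
      have := h' ξ
      have e : ((2 * c : ℝ) : ℂ) * ((‖ξ‖ : ℝ) : ℂ) ^ 2 = ((2 * c * ‖ξ‖ ^ 2 : ℝ) : ℂ) := by
        push_cast; ring
      change 0 ≤ (⟪ξ, W ξ⟫_ℂ + (starRingEnd ℂ) ⟪ξ, W ξ⟫_ℂ -
        ((2 * c : ℝ) : ℂ) * ((‖ξ‖ : ℝ) : ℂ) ^ 2).re
      rw [e, Complex.sub_re, Complex.add_re, Complex.conj_re, Complex.ofReal_re]
      linarith
  have h1 := φ.map_nonneg hpos
  rw [map_sub, map_add, map_smul, hφ, map_star] at h1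
  have := (Complex.le_def.1 h1).1
  simp at this
  linarith

end VectorFunctionals

/-! ### Day's trick -/

section Approximation

open FiniteRankFunctional

variable {H : Type*} [NormedAddCommGroup H] [InnerProductSpace ℂ H]

/-- The defects of invariance under `T ↦ star (v i) * T * v i`, and the value at `T`, of the vector
state of `ξ`. -/
def invarianceDefect {ι : Type*} (v : ι → H →L[ℂ] H) (T : H →L[ℂ] H) (ξ : H) :
    (ι → FiniteRankFunctional H) × ℂ :=
  (fun i => vector ξ ξ -
    vector (v i ξ) (v i ξ), ⟪ξ, T ξ⟫_ℂ)

variable [CompleteSpace H]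

/-- Otherwise Hahn–Banach separates the point from the convex set. A functional on finite rank
functionals is evaluation at an operator, so the separating functional, at the defect of `ξ`, is
`⟪ξ, W ξ⟫` for a single operator `W`. Its value at the given point is `φ W` by invariance, and a
state cannot fall below a lower bound of the numerical range. -/
theorem mem_closure_convexHull_invarianceDefect {ι : Type*} [Fintype ι]
    (φ : (H →L[ℂ] H) →ₚ[ℂ] ℂ) (hφ : φ 1 = 1) (v : ι → H →L[ℂ] H)
    (hv : ∀ i V, φ (star (v i) * V * v i) = φ V) (T : H →L[ℂ] H) :
    ((0, φ T) : (ι → FiniteRankFunctional H) × ℂ) ∈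
      closure (convexHull ℝ (invarianceDefect v T '' {ξ | ‖ξ‖ = 1})) := by
  classical
  by_contra hmem
  obtain ⟨f, u, hu, hf⟩ := RCLike.geometric_hahn_banach_point_closed (𝕜 := ℂ)
    (convex_convexHull ℝ (invarianceDefect v T '' {ξ | ‖ξ‖ = 1})).closure isClosed_closure hmem
  have hV : ∀ i, ∃ V : H →L[ℂ] H, ∀ ω : FiniteRankFunctional H,
      f (Pi.single i ω, 0) = toDual H ω V := fun i =>
    exists_eval_of_dual_finiteRankFunctional
      (f ∘L ContinuousLinearMap.inl ℂ _ ℂ ∘L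
        ContinuousLinearMap.single ℂ (fun _ => FiniteRankFunctional H) i)
  choose V hV using hV
  have hdec : ∀ p : (ι → FiniteRankFunctional H) × ℂ,
      f p = ∑ i, toDual H (p.1 i) (V i) + f (0, 1) * p.2 := fun p => by
    have e : p = ∑ i, ((Pi.single i (p.1 i), 0) : (ι → FiniteRankFunctional H) × ℂ) +
        p.2 • (0, 1) := by
      refine Prod.ext ?_ ?_
      · simp [Prod.fst_sum, Finset.univ_sum_single]
      · simp [Prod.snd_sum]
    conv_lhs => rw [e]
    rw [map_add, map_sum, map_smul, smul_eq_mul, mul_comm]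
    simp_rw [hV]
  let W : H →L[ℂ] H := ∑ i, (V i - star (v i) * V i * v i) + f (0, 1) • T
  have hW : φ W = f (0, 1) * φ T := by
    simp [W, hv]
  have key : u ≤ (φ W).re := by
    refine le_re_state_of_forall_le φ hφ W u fun ξ hξ => ?_
    have h1 := hf _ (subset_closure (subset_convexHull ℝ _ ⟨ξ, hξ, rfl⟩))
    rw [hdec] at h1
    refine h1.le.trans_eq ?_
    rw [show ∀ z : ℂ, RCLike.re z = z.re from fun _ => rfl]
    congr 1
    simp only [invarianceDefect, W, add_apply, sum_apply, sub_apply,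
      smul_apply, inner_add_right, inner_sum, inner_sub_right, inner_smul_right,
      mul_apply_eq_comp, ContinuousLinearMap.star_eq_adjoint,
      ContinuousLinearMap.adjoint_inner_right]
    congr 1
  rw [hdec] at hu
  simp only [Pi.zero_apply, map_zero, zero_apply, Finset.sum_const_zero,
    zero_add] at hu
  rw [← hW] at hu
  exact absurd hu (not_lt.2 key)

/-- **Day's trick**: an invariant state is approximated by finite rank states which are almost
invariant in norm. -/
theorem exists_almost_invariant_vectors {ι : Type*} [Fintype ι]
    (φ : (H →L[ℂ] H) →ₚ[ℂ] ℂ) (hφ : φ 1 = 1) (v : ι → H →L[ℂ] H)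
    (hv : ∀ i V, φ (star (v i) * V * v i) = φ V) (T : H →L[ℂ] H) {δ : ℝ} (hδ : 0 < δ) :
    ∃ (κ : Type) (_ : Fintype κ) (ξ : κ → H), ∑ k, ‖ξ k‖ ^ 2 = 1 ∧
      (∀ i (V : H →L[ℂ] H), ‖V‖ ≤ 1 → ‖∑ k, ⟪ξ k, V (ξ k)⟫_ℂ - ∑ k, ⟪v i (ξ k), V (v i (ξ k))⟫_ℂ‖ ≤ δ) ∧
      ‖∑ k, ⟪ξ k, T (ξ k)⟫_ℂ - φ T‖ ≤ δ := by
  obtain ⟨p, hp, hpd⟩ := Metric.mem_closure_iff.1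
    (mem_closure_convexHull_invarianceDefect φ hφ v hv T) δ hδ
  obtain ⟨κ, _, w, z, hw0, hw1, hz, rfl⟩ := mem_convexHull_iff_exists_fintype.1 hp
  choose ξ hξ hz using hz
  have hinner : ∀ (k : κ) (A B : H →L[ℂ] H),
      ⟪A (((√(w k) : ℝ) : ℂ) • ξ k), B (((√(w k) : ℝ) : ℂ) • ξ k)⟫_ℂ =
        w k * ⟪A (ξ k), B (ξ k)⟫_ℂ := fun k A B => by
    rw [map_smul, map_smul, inner_smul_left, inner_smul_right, ← mul_assoc, Complex.conj_ofReal,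
      ← Complex.ofReal_mul, Real.mul_self_sqrt (hw0 k)]
  rw [dist_comm, dist_eq_norm] at hpd
  -- Scaling by `√(w k)` absorbs the convex weights into the vectors.
  refine ⟨κ, inferInstance, fun k => ((√(w k) : ℝ) : ℂ) • ξ k, ?_, fun i V hV => ?_, ?_⟩
  · rw [← hw1]
    refine Finset.sum_congr rfl fun k _ => ?_
    have : ‖ξ k‖ = 1 := hξ k
    rw [norm_smul, this, mul_one, Complex.norm_real, Real.norm_eq_abs, sq_abs,
      Real.sq_sqrt (hw0 k)]
  · have h1 : ‖((∑ k, w k • z k).1 i)‖ ≤ δ :=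
      (norm_le_pi_norm (∑ k, w k • z k).1 i).trans
        (by simpa using (norm_fst_le _).trans hpd.le)
    have h2 : ‖toDual H ((∑ k, w k • z k).1 i) V‖ ≤ δ := by
      refine (ContinuousLinearMap.le_opNorm _ V).trans ?_
      rw [(toDual H).norm_map]
      calc _ ≤ δ * 1 := mul_le_mul h1 hV (norm_nonneg _) hδ.le
        _ = δ := mul_one δ
    convert h2 using 2
    rw [← Finset.sum_sub_distrib, Prod.fst_sum, Finset.sum_apply,
      map_sum, sum_apply]
    refine Finset.sum_congr rfl fun k _ => ?_
    have e1 := hinner k 1 V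
    have e2 := hinner k (v i) (V * v i)
    simp only [one_apply_eq_self, mul_apply_eq_comp] at e1 e2
    rw [e1, e2, ← hz, ← mul_sub]
    rfl
  · have h1 : ‖(∑ k, w k • z k).2 - φ T‖ ≤ δ := (norm_snd_le _).trans hpd.le
    convert h1 using 3
    rw [Prod.snd_sum]
    refine Finset.sum_congr rfl fun k _ => ?_
    have e1 := hinner k 1 T
    simp only [one_apply_eq_self] at e1
    rw [e1, ← hz]
    rfl

end Approximation

/-! ### Diagonalization and the Powers–Størmer inequality -/

section FiniteRank

variable {H : Type*} [NormedAddCommGroup H] [InnerProductSpace ℂ H]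

/-- A finite rank positive operator, given as a sum of squares of vectors, is diagonalized by an
orthonormal family. -/
theorem exists_orthonormal_sum_inner_eq {κ : Type*} [Fintype κ] (ξ : κ → H) :
    ∃ (n : ℕ) (e : Fin n → H) (s : Fin n → ℝ), Orthonormal ℂ e ∧ (∀ m, 0 ≤ s m) ∧
      ∀ A B : H →L[ℂ] H,
        ∑ k, ⟪A (ξ k), B (ξ k)⟫_ℂ = ∑ m, ((s m ^ 2 : ℝ) : ℂ) * ⟪A (e m), B (e m)⟫_ℂ := by
  let K := Submodule.span ℂ (Set.range ξ)
  have : FiniteDimensional ℂ K := FiniteDimensional.span_of_finite ℂ (Set.finite_range ξ)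
  let ζ : κ → K := fun k => ⟨ξ k, Submodule.subset_span ⟨k, rfl⟩⟩
  -- The density operator of the family; its eigenvectors are the required orthonormal family, and
  -- the `s m` are the square roots of its eigenvalues.
  let G : K →ₗ[ℂ] K := ∑ k, (innerₛₗ ℂ (ζ k)).smulRight (ζ k)
  have hG : ∀ x, G x = ∑ k, ⟪ζ k, x⟫_ℂ • ζ k := fun x => by simp [G]
  have hsymm : G.IsSymmetric := fun x y => by
    simp only [hG, sum_inner, inner_sum, inner_smul_left, inner_smul_right, inner_conj_symm]
    exact Finset.sum_congr rfl fun k _ => mul_comm _ _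
  let b := hsymm.eigenvectorBasis rfl
  let μ := hsymm.eigenvalues rfl
  have hGb : ∀ l m, ∑ k, ⟪ζ k, b m⟫_ℂ * ⟪b l, ζ k⟫_ℂ = if l = m then (μ m : ℂ) else 0 :=
    fun l m => by
      have h1 : ⟪b l, G (b m)⟫_ℂ = if l = m then (μ m : ℂ) else 0 := by
        rw [hsymm.apply_eigenvectorBasis, inner_smul_right,
          orthonormal_iff_ite.1 b.orthonormal l m]
        simp [μ]
      rw [← h1, hG, inner_sum]
      simp_rw [inner_smul_right]
  have hμ : ∀ m, 0 ≤ μ m := fun m => by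
    have h1 := hGb m m
    rw [if_pos rfl] at h1
    have h2 : ((∑ k, ‖⟪b m, ζ k⟫_ℂ‖ ^ 2 : ℝ) : ℂ) = μ m := by
      rw [← h1, Complex.ofReal_sum]
      refine Finset.sum_congr rfl fun k _ => ?_
      rw [Complex.ofReal_pow, ← Complex.conj_mul', inner_conj_symm]
    rw [← Complex.ofReal_inj.1 h2]
    positivity
  refine ⟨_, fun m => (b m : H), fun m => √(μ m), ?_, fun m => Real.sqrt_nonneg _,
    fun A B => ?_⟩
  · exact b.orthonormal.comp_linearIsometry K.subtypeₗᵢ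
  have hξ : ∀ k, ξ k = ∑ m, ⟪b m, ζ k⟫_ℂ • (b m : H) := fun k => by
    have := congrArg (Subtype.val) (b.sum_repr' (ζ k))
    simpa [ζ] using this.symm
  calc ∑ k, ⟪A (ξ k), B (ξ k)⟫_ℂ
      = ∑ k, ∑ m, ∑ l, (⟪ζ k, b m⟫_ℂ * ⟪b l, ζ k⟫_ℂ) * ⟪A (b m), B (b l)⟫_ℂ := by
        refine Finset.sum_congr rfl fun k _ => ?_
        rw [hξ k, map_sum, map_sum, sum_inner]
        refine Finset.sum_congr rfl fun m _ => ?_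
        rw [inner_sum]
        refine Finset.sum_congr rfl fun l _ => ?_
        rw [map_smul, map_smul, inner_smul_left, inner_smul_right, inner_conj_symm, mul_assoc]
    _ = ∑ m, ∑ l, (∑ k, ⟪ζ k, b m⟫_ℂ * ⟪b l, ζ k⟫_ℂ) * ⟪A (b m), B (b l)⟫_ℂ := by
        rw [Finset.sum_comm]
        refine Finset.sum_congr rfl fun m _ => ?_
        rw [Finset.sum_comm]
        exact Finset.sum_congr rfl fun l _ => (Finset.sum_mul _ _ _).symm
    _ = ∑ m, ((√(μ m) ^ 2 : ℝ) : ℂ) * ⟪A (b m), B (b m)⟫_ℂ := by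
        refine Finset.sum_congr rfl fun m _ => ?_
        simp_rw [hGb]
        simp [Real.sq_sqrt (hμ m)]

/-- The operator which is diagonal in an orthonormal basis, with entries in the unit disc, is a
contraction. -/
theorem exists_contraction_diagonal {E : Type*} [NormedAddCommGroup E] [InnerProductSpace ℂ E]
    {κ : Type*} [Fintype κ] (b : OrthonormalBasis κ ℂ E) (c : κ → ℝ) (hc : ∀ m, |c m| ≤ 1) :
    ∃ V : E →L[ℂ] E, ‖V‖ ≤ 1 ∧
      ∀ x, ⟪x, V x⟫_ℂ = ((∑ m, c m * ‖⟪b m, x⟫_ℂ‖ ^ 2 : ℝ) : ℂ) := by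
  let V : E →L[ℂ] E := ∑ m, (innerSL ℂ (b m)).smulRight ((c m : ℂ) • b m)
  have hV : ∀ x, V x = ∑ m, ⟪b m, x⟫_ℂ • (c m : ℂ) • b m := fun x => by simp [V]
  refine ⟨V, ContinuousLinearMap.opNorm_le_bound _ zero_le_one fun x => ?_, fun x => ?_⟩
  · rw [one_mul, ← sq_le_sq₀ (norm_nonneg _) (norm_nonneg _), ← b.sum_sq_norm_inner_right (V x),
      ← b.sum_sq_norm_inner_right x]
    classical
    refine Finset.sum_le_sum fun m _ => ?_
    have : ⟪b m, V x⟫_ℂ = ⟪b m, x⟫_ℂ * c m := by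
      rw [hV, inner_sum]
      simp_rw [inner_smul_right, orthonormal_iff_ite.1 b.orthonormal]
      simp
    rw [this, norm_mul, Complex.norm_real, mul_pow]
    have h1 : ‖c m‖ ^ 2 ≤ 1 := pow_le_one₀ (norm_nonneg _) (hc m)
    nlinarith [sq_nonneg ‖⟪b m, x⟫_ℂ‖]
  · rw [hV, inner_sum, Complex.ofReal_sum]
    refine Finset.sum_congr rfl fun m _ => ?_
    rw [inner_smul_right, inner_smul_right, Complex.ofReal_mul, Complex.ofReal_pow,
      ← Complex.conj_mul', inner_conj_symm]
    ring

/-- The **Powers–Størmer inequality** for finite rank operators with equal spectra, in finite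
dimension. -/
theorem powers_stormer_finiteDimensional {E : Type*} [NormedAddCommGroup E]
    [InnerProductSpace ℂ E] [FiniteDimensional ℂ E] {κ : Type*} [Fintype κ] {e g : κ → E}
    (he : Orthonormal ℂ e) (hg : Orthonormal ℂ g) {s : κ → ℝ} (hs : ∀ k, 0 ≤ s k) :
    ∃ V : E →L[ℂ] E, ‖V‖ ≤ 1 ∧
      2 * ∑ k, s k ^ 2 - 2 * ∑ k, ∑ l, s k * s l * ‖⟪e k, g l⟫_ℂ‖ ^ 2 ≤
        (∑ k, ((s k ^ 2 : ℝ) : ℂ) * ⟪e k, V (e k)⟫_ℂ -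
          ∑ k, ((s k ^ 2 : ℝ) : ℂ) * ⟪g k, V (g k)⟫_ℂ).re := by
  classical
  -- For orthonormal `e`, this is the positive square root of the density with eigenvectors `e k`
  -- and eigenvalues `s k ^ 2`.
  let S : (κ → E) → E →ₗ[ℂ] E := fun e => ∑ k, (innerₛₗ ℂ (e k)).smulRight ((s k : ℂ) • e k)
  have hS : ∀ e x, S e x = ∑ k, ⟪e k, x⟫_ℂ • (s k : ℂ) • e k := fun e x => by simp [S]
  have hSsymm : ∀ e, (S e).IsSymmetric := fun e x y => by
    simp only [hS, sum_inner, inner_sum, inner_smul_left, inner_smul_right, inner_conj_symm,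
      Complex.conj_ofReal]
    exact Finset.sum_congr rfl fun k _ => by ring
  have hSnorm : ∀ e : κ → E, Orthonormal ℂ e → ∀ x,
      ‖S e x‖ ^ 2 = ∑ k, s k ^ 2 * ‖⟪e k, x⟫_ℂ‖ ^ 2 := fun e he x => by
    have h1 : S e x = ∑ k, (⟪e k, x⟫_ℂ * s k) • e k := by simp_rw [hS, smul_smul]
    rw [← Complex.ofReal_inj, Complex.ofReal_pow]
    refine (inner_self_eq_norm_sq_to_K (𝕜 := ℂ) (S e x)).symm.trans ?_
    rw [h1, he.inner_sum, Complex.ofReal_sum]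
    refine Finset.sum_congr rfl fun k _ => ?_
    rw [map_mul, Complex.conj_ofReal, Complex.ofReal_mul, Complex.ofReal_pow, Complex.ofReal_pow,
      ← Complex.conj_mul']
    ring
  have hSpos : ∀ (e : κ → E) x, 0 ≤ (⟪x, S e x⟫_ℂ).re := fun e x => by
    have h1 : ⟪x, S e x⟫_ℂ = ((∑ k, s k * ‖⟪e k, x⟫_ℂ‖ ^ 2 : ℝ) : ℂ) := by
      rw [hS, inner_sum, Complex.ofReal_sum]
      refine Finset.sum_congr rfl fun k _ => ?_
      rw [inner_smul_right, inner_smul_right, Complex.ofReal_mul, Complex.ofReal_pow,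
        ← Complex.mul_conj', inner_conj_symm]
      ring
    rw [h1, Complex.ofReal_re]
    exact Finset.sum_nonneg fun k _ => mul_nonneg (hs k) (sq_nonneg _)
  have hD : (S e - S g).IsSymmetric := (hSsymm e).sub (hSsymm g)
  let b := hD.eigenvectorBasis rfl
  let d := hD.eigenvalues rfl
  have hDb : ∀ m, S e (b m) - S g (b m) = (d m : ℂ) • b m := fun m =>
    hD.apply_eigenvectorBasis rfl m
  -- The test contraction is the sign of the self-adjoint operator `S e - S g`.
  obtain ⟨V, hV1, hV⟩ := exists_contraction_diagonal b (fun m => (SignType.sign (d m) : ℝ))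
    (fun m => by rcases lt_trichotomy (d m) 0 with h | h | h <;> simp [h])
  have hVsum : ∀ e : κ → E, Orthonormal ℂ e →
      (∑ k, ((s k ^ 2 : ℝ) : ℂ) * ⟪e k, V (e k)⟫_ℂ).re =
        ∑ m, (SignType.sign (d m) : ℝ) * ‖S e (b m)‖ ^ 2 := fun e he => by
    simp_rw [hV, ← Complex.ofReal_mul, ← Complex.ofReal_sum, Complex.ofReal_re, hSnorm e he,
      Finset.mul_sum]
    rw [Finset.sum_comm]
    refine Finset.sum_congr rfl fun m _ => Finset.sum_congr rfl fun k _ => ?_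
    rw [norm_inner_symm]
    ring
  have hSsum : ∀ e : κ → E, Orthonormal ℂ e → ∑ m, ‖S e (b m)‖ ^ 2 = ∑ k, s k ^ 2 :=
    fun e he => by
      simp_rw [hSnorm e he]
      rw [Finset.sum_comm]
      refine Finset.sum_congr rfl fun k _ => ?_
      rw [← Finset.mul_sum, b.sum_sq_norm_inner_left, he.1 k]
      ring
  -- Both sides are the trace of `S e * S g`: on the left in the basis `b`, on the right after
  -- Parseval.
  have hcross : ∑ m, (⟪S e (b m), S g (b m)⟫_ℂ).re =
      ∑ k, ∑ l, s k * s l * ‖⟪e k, g l⟫_ℂ‖ ^ 2 := by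
    rw [← Complex.re_sum, ← Complex.ofReal_re (∑ k, ∑ l, s k * s l * ‖⟪e k, g l⟫_ℂ‖ ^ 2)]
    congr 1
    simp_rw [hS, sum_inner, inner_sum, inner_smul_left, inner_smul_right, inner_conj_symm]
    rw [Finset.sum_comm, Complex.ofReal_sum]
    refine Finset.sum_congr rfl fun k _ => ?_
    rw [Finset.sum_comm, Complex.ofReal_sum]
    refine Finset.sum_congr rfl fun l _ => ?_
    have h1 := b.sum_inner_mul_inner (g l) (e k)
    rw [Complex.ofReal_mul, Complex.ofReal_mul, Complex.ofReal_pow, ← Complex.conj_mul',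
      inner_conj_symm, ← h1, Finset.sum_mul, Finset.mul_sum]
    refine Finset.sum_congr rfl fun m _ => ?_
    rw [Complex.conj_ofReal]
    ring
  -- With `p` and `q` the diagonal entries of `S e` and `S g` at `b m`, the left side is `d m ^ 2`
  -- and the right side is `|d m| * (p + q)`. Since `d m = p - q` with `p` and `q` nonnegative, `|d
  -- m| ≤ p + q`.
  have hterm : ∀ m, ‖S e (b m)‖ ^ 2 + ‖S g (b m)‖ ^ 2 - 2 * (⟪S e (b m), S g (b m)⟫_ℂ).re ≤
      (SignType.sign (d m) : ℝ) * (‖S e (b m)‖ ^ 2 - ‖S g (b m)‖ ^ 2) := fun m => by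
    have hb : ‖b m‖ = 1 := b.orthonormal.1 m
    have h1 : ‖S e (b m)‖ ^ 2 + ‖S g (b m)‖ ^ 2 - 2 * (⟪S e (b m), S g (b m)⟫_ℂ).re =
        d m ^ 2 := by
      have h := norm_sub_sq (𝕜 := ℂ) (S e (b m)) (S g (b m))
      rw [hDb, norm_smul, hb, mul_one, Complex.norm_real, Real.norm_eq_abs, sq_abs] at h
      rw [h]
      change _ = _ - 2 * (⟪S e (b m), S g (b m)⟫_ℂ).re + _
      ring
    set p := (⟪b m, S e (b m)⟫_ℂ).re with hp
    set q := (⟪b m, S g (b m)⟫_ℂ).re with hq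
    have hpq : p - q = d m := by
      rw [hp, hq, ← Complex.sub_re, ← inner_sub_right, hDb, inner_smul_right,
        inner_self_eq_norm_sq_to_K, hb]
      simp
    have h2 : ‖S e (b m)‖ ^ 2 - ‖S g (b m)‖ ^ 2 = d m * (p + q) := by
      have h3 : S e (b m) = S g (b m) + (d m : ℂ) • b m := by rw [← hDb]; abel
      have h4 := norm_add_sq (𝕜 := ℂ) (S g (b m)) ((d m : ℂ) • b m)
      rw [← h3, norm_smul, hb, mul_one, Complex.norm_real, Real.norm_eq_abs, sq_abs,
        inner_smul_right, ← inner_conj_symm] at h4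
      have h5 : RCLike.re ((d m : ℂ) * (starRingEnd ℂ) ⟪b m, S g (b m)⟫_ℂ) = d m * q := by
        change ((d m : ℂ) * (starRingEnd ℂ) ⟪b m, S g (b m)⟫_ℂ).re = _
        rw [Complex.re_ofReal_mul, Complex.conj_re]
      rw [h5] at h4
      rw [h4, ← hpq]
      ring
    have hp0 : 0 ≤ p := hSpos e (b m)
    have hq0 : 0 ≤ q := hSpos g (b m)
    rw [h1, h2, ← mul_assoc, sign_mul_self, ← sq_abs, sq]
    refine mul_le_mul_of_nonneg_left ?_ (abs_nonneg _)
    rw [← hpq, abs_le]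
    constructor <;> linarith
  refine ⟨V, hV1, ?_⟩
  rw [Complex.sub_re, hVsum e he, hVsum g hg, ← Finset.sum_sub_distrib]
  calc _ = ∑ m, (‖S e (b m)‖ ^ 2 + ‖S g (b m)‖ ^ 2 - 2 * (⟪S e (b m), S g (b m)⟫_ℂ).re) := by
        rw [Finset.sum_sub_distrib, Finset.sum_add_distrib, hSsum e he, hSsum g hg,
          ← Finset.mul_sum, hcross]
        ring
    _ ≤ _ := Finset.sum_le_sum fun m _ => (hterm m).trans_eq (mul_sub _ _ _)

/-- The **Powers–Størmer inequality** for finite rank operators with equal spectra. -/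
theorem powers_stormer {κ : Type*} [Fintype κ] {e g : κ → H}
    (he : Orthonormal ℂ e) (hg : Orthonormal ℂ g) {s : κ → ℝ} (hs : ∀ k, 0 ≤ s k) {δ : ℝ}
    (hδ : ∀ V : H →L[ℂ] H, ‖V‖ ≤ 1 → ‖∑ k, ((s k ^ 2 : ℝ) : ℂ) * ⟪e k, V (e k)⟫_ℂ -
      ∑ k, ((s k ^ 2 : ℝ) : ℂ) * ⟪g k, V (g k)⟫_ℂ‖ ≤ δ) :
    2 * ∑ k, s k ^ 2 - 2 * ∑ k, ∑ l, s k * s l * ‖⟪e k, g l⟫_ℂ‖ ^ 2 ≤ δ := by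
  let K := Submodule.span ℂ (Set.range e ∪ Set.range g)
  have : FiniteDimensional ℂ K :=
    FiniteDimensional.span_of_finite ℂ ((Set.finite_range e).union (Set.finite_range g))
  let e' : κ → K := fun k => ⟨e k, Submodule.subset_span (Or.inl ⟨k, rfl⟩)⟩
  let g' : κ → K := fun k => ⟨g k, Submodule.subset_span (Or.inr ⟨k, rfl⟩)⟩
  have he' : Orthonormal ℂ e' := (K.subtypeₗᵢ.orthonormal_comp_iff (v := e')).1 he
  have hg' : Orthonormal ℂ g' := (K.subtypeₗᵢ.orthonormal_comp_iff (v := g')).1 hg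
  obtain ⟨V, hV1, hV⟩ := powers_stormer_finiteDimensional he' hg' hs
  -- Extending by zero on the orthogonal complement keeps a contraction and its values on `K`.
  let V' : H →L[ℂ] H := K.subtypeL ∘L V ∘L K.orthogonalProjectionOnto
  have hV' : ‖V'‖ ≤ 1 := by
    refine ContinuousLinearMap.opNorm_le_bound _ zero_le_one fun x => ?_
    calc ‖V' x‖ = ‖V (K.orthogonalProjectionOnto x)‖ := rfl
      _ ≤ 1 * ‖K.orthogonalProjectionOnto x‖ := V.le_of_opNorm_le hV1 _
      _ ≤ 1 * ‖x‖ := by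
        gcongr
        exact K.norm_orthogonalProjectionOnto_apply_le x
  have hinner : ∀ x : K, ⟪(x : H), V' x⟫_ℂ = ⟪x, V x⟫_ℂ := fun x => by
    simp [V']
  have h1 := hδ V' hV'
  have h2 : ∀ k, ⟪e k, V' (e k)⟫_ℂ = ⟪e' k, V (e' k)⟫_ℂ := fun k => hinner (e' k)
  have h3 : ∀ k, ⟪g k, V' (g k)⟫_ℂ = ⟪g' k, V (g' k)⟫_ℂ := fun k => hinner (g' k)
  simp_rw [h2, h3] at h1
  exact hV.trans ((Complex.re_le_norm _).trans h1)

end FiniteRank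

/-! ### Diagonal vectors in the tensor product with the conjugate space -/

section Tensor

open ConjHilbert

theorem norm_opTensor_le {H K : Type*} [NormedAddCommGroup H] [InnerProductSpace ℂ H]
    [NormedAddCommGroup K] [InnerProductSpace ℂ K] (x : H →L[ℂ] H) (y : K →L[ℂ] K) :
    ‖opTensor x y‖ ≤ ‖x‖ * ‖y‖ := by
  refine ContinuousLinearMap.opNorm_le_bound _ (by positivity) fun z => ?_
  induction z using UniformSpace.Completion.induction_on with
  | hp => exact isClosed_le (by fun_prop) (by fun_prop)
  | ih z =>
    have : opTensor x y (z : HilbertTensor H K) =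
        ((TensorProduct.mapL x y z : H ⊗[ℂ] K) : HilbertTensor H K) := by simp [opTensor]
    rw [this, UniformSpace.Completion.norm_coe, UniformSpace.Completion.norm_coe]
    exact (TensorProduct.mapL x y).le_of_opNorm_le (TensorProduct.norm_mapL_le x y) z

variable {H : Type*} [NormedAddCommGroup H] [InnerProductSpace ℂ H]

theorem norm_conjOp_le (x : H →L[ℂ] H) : ‖conjOp x‖ ≤ ‖x‖ := by
  refine ContinuousLinearMap.opNorm_le_bound _ (norm_nonneg _) fun ξ => ?_
  obtain ⟨ξ, rfl⟩ := (bar H).surjective ξ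
  rw [conjOp_bar, LinearIsometryEquiv.norm_map, LinearIsometryEquiv.norm_map]
  exact x.le_opNorm ξ

/-- The vector `∑ s k • e k ⊗ ē k`. -/
def diagonalVector {κ : Type*} [Fintype κ] (s : κ → ℝ) (e : κ → H) :
    HilbertTensor H (ConjHilbert H) :=
  ∑ k, (s k : ℂ) • ((e k ⊗ₜ[ℂ] bar H (e k) : H ⊗[ℂ] ConjHilbert H) :
    HilbertTensor H (ConjHilbert H))

theorem opTensor_conjOp_diagonalVector {κ : Type*} [Fintype κ] (s : κ → ℝ) (e : κ → H)
    (y : H →L[ℂ] H) :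
    opTensor y (conjOp y) (diagonalVector s e) = diagonalVector s fun k => y (e k) := by
  simp only [diagonalVector, map_sum, map_smul, opTensor_tmul, conjOp_bar]

/-- This is the cross term of the Powers–Størmer inequality, which thereby becomes a bound on the
distance between diagonal vectors. -/
theorem inner_diagonalVector {κ : Type*} [Fintype κ] (s : κ → ℝ) (e g : κ → H) :
    ⟪diagonalVector s e, diagonalVector s g⟫_ℂ =
      ((∑ k, ∑ l, s k * s l * ‖⟪e k, g l⟫_ℂ‖ ^ 2 : ℝ) : ℂ) := by
  simp only [diagonalVector, sum_inner, inner_sum, inner_smul_left, inner_smul_right,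
    UniformSpace.Completion.inner_coe, TensorProduct.inner_tmul, inner_bar_bar,
    Complex.ofReal_sum]
  simp_rw [Finset.mul_sum]
  rw [Finset.sum_comm]
  refine Finset.sum_congr rfl fun k _ => Finset.sum_congr rfl fun l _ => ?_
  rw [Complex.ofReal_mul, Complex.ofReal_mul, Complex.ofReal_pow, ← Complex.mul_conj',
    inner_conj_symm, Complex.conj_ofReal]
  ring

theorem norm_diagonalVector {κ : Type*} [Fintype κ] {s : κ → ℝ} (hs : ∑ k, s k ^ 2 = 1)
    {e : κ → H} (he : Orthonormal ℂ e) : ‖diagonalVector s e‖ = 1 := by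
  classical
  have h := inner_diagonalVector s e e
  rw [inner_self_eq_norm_sq_to_K] at h
  have h1 : ‖diagonalVector s e‖ ^ 2 = ∑ k, ∑ l, s k * s l * ‖⟪e k, e l⟫_ℂ‖ ^ 2 := by
    rw [← Complex.ofReal_inj, Complex.ofReal_pow]
    exact h
  have h2 : ∑ k, ∑ l, s k * s l * ‖⟪e k, e l⟫_ℂ‖ ^ 2 = 1 := by
    rw [← hs]
    refine Finset.sum_congr rfl fun k _ => ?_
    rw [Finset.sum_eq_single k (fun l _ hl => by rw [he.2 hl.symm]; simp) (by simp),
      inner_self_eq_norm_sq_to_K, he.1 k]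
    simp [sq]
  rw [h2] at h1
  exact (pow_eq_one_iff_of_nonneg (norm_nonneg _) two_ne_zero).1 h1

/-- Cauchy–Schwarz with weights of total mass `1` bounds the left side by the diagonal part of the
double sum on the right, whose terms are all nonnegative. -/
theorem norm_sum_inner_sq_le {κ : Type*} [Fintype κ] {s : κ → ℝ} (hs0 : ∀ k, 0 ≤ s k)
    (hs : ∑ k, s k ^ 2 = 1) (e : κ → H) (y : H →L[ℂ] H) :
    ‖∑ k, ((s k ^ 2 : ℝ) : ℂ) * ⟪e k, y (e k)⟫_ℂ‖ ^ 2 ≤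
      ‖⟪diagonalVector s e, opTensor y (conjOp y) (diagonalVector s e)⟫_ℂ‖ := by
  rw [opTensor_conjOp_diagonalVector, inner_diagonalVector, Complex.norm_real]
  refine le_trans ?_ (le_abs_self _)
  calc ‖∑ k, ((s k ^ 2 : ℝ) : ℂ) * ⟪e k, y (e k)⟫_ℂ‖ ^ 2
      ≤ (∑ k, s k * (s k * ‖⟪e k, y (e k)⟫_ℂ‖)) ^ 2 := by
        gcongr
        refine (norm_sum_le _ _).trans (Finset.sum_le_sum fun k _ => ?_)
        rw [norm_mul, Complex.norm_real, Real.norm_of_nonneg (sq_nonneg _)]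
        exact (by ring : _ = _).le
    _ ≤ (∑ k, s k ^ 2) * ∑ k, (s k * ‖⟪e k, y (e k)⟫_ℂ‖) ^ 2 :=
        Finset.sum_mul_sq_le_sq_mul_sq _ _ _
    _ = ∑ k, s k * s k * ‖⟪e k, y (e k)⟫_ℂ‖ ^ 2 := by
        rw [hs, one_mul]
        exact Finset.sum_congr rfl fun k _ => by ring
    _ ≤ ∑ k, ∑ l, s k * s l * ‖⟪e k, y (e l)⟫_ℂ‖ ^ 2 :=
        Finset.sum_le_sum fun k _ =>
          Finset.single_le_sum (f := fun l => s k * s l * ‖⟪e k, y (e l)⟫_ℂ‖ ^ 2)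
            (fun l _ => mul_nonneg (mul_nonneg (hs0 k) (hs0 l)) (sq_nonneg _))
            (Finset.mem_univ k)

theorem norm_sub_sq_le_of_inner {E : Type*} [NormedAddCommGroup E] [InnerProductSpace ℂ E]
    {z z' : E} (hz : ‖z‖ ≤ 1) (hz' : ‖z'‖ ≤ 1) : ‖z' - z‖ ^ 2 ≤ 2 - 2 * (⟪z, z'⟫_ℂ).re := by
  have h := norm_sub_sq (𝕜 := ℂ) z z'
  rw [norm_sub_rev] at h
  rw [h]
  change ‖z‖ ^ 2 - 2 * (⟪z, z'⟫_ℂ).re + ‖z'‖ ^ 2 ≤ _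
  have h1 : ‖z‖ ^ 2 ≤ 1 := pow_le_one₀ (norm_nonneg _) hz
  have h2 : ‖z'‖ ^ 2 ≤ 1 := pow_le_one₀ (norm_nonneg _) hz'
  linarith

/-- A contraction and its adjoint both almost fix a unit vector which the contraction almost
fixes. -/
theorem norm_sub_le_of_re_inner {E : Type*} [NormedAddCommGroup E] [InnerProductSpace ℂ E]
    [CompleteSpace E] {z : E} (hz : ‖z‖ = 1) {U : E →L[ℂ] E} (hU : ‖U‖ ≤ 1) {η : ℝ} (hη : 0 ≤ η)
    (h : 2 - 2 * (⟪z, U z⟫_ℂ).re ≤ η ^ 2) : ‖U z - z‖ ≤ η ∧ ‖star U z - z‖ ≤ η := by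
  have hz' : ∀ W : E →L[ℂ] E, ‖W‖ ≤ 1 → ‖W z‖ ≤ 1 := fun W hW =>
    (W.le_of_opNorm_le hW z).trans (by rw [hz, one_mul])
  refine ⟨(sq_le_sq₀ (norm_nonneg _) hη).1 ((norm_sub_sq_le_of_inner hz.le (hz' U hU)).trans h),
    (sq_le_sq₀ (norm_nonneg _) hη).1
      ((norm_sub_sq_le_of_inner hz.le (hz' _ (by rwa [norm_star]))).trans ?_)⟩
  -- The values of `U` and `star U` at `z` are complex conjugates, so they have the same real part.
  rwa [ContinuousLinearMap.star_eq_adjoint, ContinuousLinearMap.adjoint_inner_right,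
    ← inner_conj_symm, Complex.conj_re]

/-- The left value is that of `X` at `star U z`. Replacing this vector by `z` in each of the two
slots costs `‖X‖ * η`. -/
theorem norm_inner_conj_sub_le {E : Type*} [NormedAddCommGroup E] [InnerProductSpace ℂ E]
    [CompleteSpace E] {z : E} (hz : ‖z‖ = 1) {U : E →L[ℂ] E} (hU : ‖U‖ ≤ 1) (X : E →L[ℂ] E)
    {η : ℝ} (h : ‖star U z - z‖ ≤ η) :
    ‖⟪z, (U * X * star U) z⟫_ℂ - ⟪z, X z⟫_ℂ‖ ≤ 2 * ‖X‖ * η := by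
  set z' := star U z with hz'
  have hη : 0 ≤ η := (norm_nonneg _).trans h
  have h1 : ‖z'‖ ≤ 1 := ((star U).le_of_opNorm_le ((norm_star U).trans_le hU) z).trans
    (by rw [hz, one_mul])
  have e : ⟪z, (U * X * star U) z⟫_ℂ = ⟪z', X z'⟫_ℂ := by
    rw [hz', ContinuousLinearMap.star_eq_adjoint, ContinuousLinearMap.adjoint_inner_left]
    rfl
  have e2 : ⟪z', X z'⟫_ℂ - ⟪z, X z⟫_ℂ = ⟪z' - z, X z'⟫_ℂ + ⟪z, X (z' - z)⟫_ℂ := by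
    rw [map_sub, inner_sub_left, inner_sub_right]
    ring
  rw [e, e2]
  calc _ ≤ ‖z' - z‖ * (‖X‖ * ‖z'‖) + ‖z‖ * (‖X‖ * ‖z' - z‖) :=
        (norm_add_le _ _).trans (add_le_add
          ((norm_inner_le_norm _ _).trans (by gcongr; exact X.le_opNorm _))
          ((norm_inner_le_norm _ _).trans (by gcongr; exact X.le_opNorm _)))
    _ ≤ η * (‖X‖ * 1) + 1 * (‖X‖ * η) := by rw [hz]; gcongr
    _ = 2 * ‖X‖ * η := by ring

end Tensor

theorem exists_norm_lt_of_zero_mem_closure {E : Type*} [NormedAddCommGroup E] {s : Set E}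
    (h : (0 : E) ∈ closure s) {η : ℝ} (hη : 0 < η) : ∃ T ∈ s, ‖T‖ < η := by
  simpa using Metric.mem_closure_iff.1 h η hη

/-! ### Central states and the conjugation orbit -/

namespace VonNeumannAlgebra

open ConjHilbert

variable {H : Type*} [NormedAddCommGroup H] [InnerProductSpace ℂ H] [CompleteSpace H]
  {A : VonNeumannAlgebra H}

theorem norm_le_one_of_mem_unitary {u : H →L[ℂ] H} (hu : u ∈ unitary (H →L[ℂ] H)) :
    ‖u‖ ≤ 1 := by
  rcases subsingleton_or_nontrivial (H →L[ℂ] H) with h | h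
  · simp [Subsingleton.elim u 0]
  · exact (CStarRing.norm_of_mem_unitary hu).le

/-- Norm closedness makes `A` a C⋆-algebra, so that it is spanned by its unitaries. -/
theorem isClosed_coe (A : VonNeumannAlgebra H) : IsClosed (A : Set (H →L[ℂ] H)) := by
  rw [← A.centralizer_centralizer]
  exact Set.isClosed_centralizer _

/-- A von Neumann algebra is spanned by its unitary elements. -/
theorem mem_span_unitary (A : VonNeumannAlgebra H) {a : H →L[ℂ] H} (ha : a ∈ A) :
    a ∈ Submodule.span ℂ {u | u ∈ A ∧ u ∈ unitary (H →L[ℂ] H)} := by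
  have : IsClosed (A.toStarSubalgebra : Set (H →L[ℂ] H)) := A.isClosed_coe
  have h : (⟨a, ha⟩ : A.toStarSubalgebra) ∈
      Submodule.span ℂ (unitary A.toStarSubalgebra : Set A.toStarSubalgebra) := by
    rw [CStarAlgebra.span_unitary]
    trivial
  have h' := Submodule.mem_map_of_mem (f := A.toStarSubalgebra.toSubalgebra.val.toLinearMap) h
  rw [Submodule.map_span] at h'
  refine Submodule.span_mono ?_ h'
  rintro _ ⟨(u : A.toStarSubalgebra), hu, rfl⟩
  refine ⟨u.2, ?_⟩
  have hu := (Unitary.mem_iff (R := A.toStarSubalgebra)).1 hu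
  exact Unitary.mem_iff.2 ⟨congrArg Subtype.val hu.1, congrArg Subtype.val hu.2⟩

namespace IsCentralState

variable {φ : (H →L[ℂ] H) →ₚ[ℂ] ℂ}

theorem map_star_mul_mul (hφ : A.IsCentralState φ) {v : H →L[ℂ] H} (hvA : v ∈ A)
    (hv : v ∈ unitary (H →L[ℂ] H)) (V : H →L[ℂ] H) : φ (star v * V * v) = φ V := by
  rw [mul_assoc, hφ.map_mul_comm _ (star_mem hvA), mul_assoc, Unitary.mul_star_self_of_mem hv,
    mul_one]

/-- A central state is approximated on an operator by diagonal vectors which are almost invariant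
under finitely many unitaries. -/
theorem exists_diagonalVector (hφ : A.IsCentralState φ) {ι : Type*} [Fintype ι]
    (v : ι → H →L[ℂ] H) (hvA : ∀ i, v i ∈ A) (hv : ∀ i, v i ∈ unitary (H →L[ℂ] H))
    (y : H →L[ℂ] H) {η : ℝ} (hη : 0 < η) :
    ∃ z : HilbertTensor H (ConjHilbert H), ‖z‖ = 1 ∧
      (∀ i, ‖opTensor (v i) (conjOp (v i)) z - z‖ ≤ η ∧
        ‖star (opTensor (v i) (conjOp (v i))) z - z‖ ≤ η) ∧
      (∀ x w, opTensor (x * w) (conjOp (x * w)) z =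
        opTensor x (conjOp x) (opTensor w (conjOp w) z)) ∧
      ‖φ y‖ ≤ √‖⟪z, opTensor y (conjOp y) z⟫_ℂ‖ + η ^ 2 := by
  classical
  -- The tolerance is `η ^ 2` because Powers–Størmer bounds the square of the distance between
  -- vectors.
  obtain ⟨κ, _, ξ, hξ1, hξv, hξy⟩ := exists_almost_invariant_vectors φ hφ.map_one v
    (fun i => hφ.map_star_mul_mul (hvA i) (hv i)) y (pow_pos hη 2)
  obtain ⟨n, e, s, he, hs0, hs⟩ := exists_orthonormal_sum_inner_eq ξ
  have hs1 : ∑ m, s m ^ 2 = 1 := by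
    have h := hs 1 1
    simp only [one_apply_eq_self, inner_self_eq_norm_sq_to_K, he.1] at h
    rw [← hξ1, ← Complex.ofReal_inj, Complex.ofReal_sum, Complex.ofReal_sum]
    simpa using h.symm
  have hz := norm_diagonalVector hs1 he
  refine ⟨diagonalVector s e, hz, fun i => ?_, fun x w => ?_, ?_⟩
  · have hn : ‖v i‖ ≤ 1 := norm_le_one_of_mem_unitary (hv i)
    have hU : ‖opTensor (v i) (conjOp (v i))‖ ≤ 1 :=
      (norm_opTensor_le _ _).trans
        (mul_le_one₀ hn (norm_nonneg _) ((norm_conjOp_le _).trans hn))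
    refine norm_sub_le_of_re_inner hz hU hη.le ?_
    have hve : Orthonormal ℂ fun k => v i (e k) := by
      rw [orthonormal_iff_ite]
      intro k l
      rw [← ContinuousLinearMap.adjoint_inner_right, ← ContinuousLinearMap.star_eq_adjoint,
        ← mul_apply_eq_comp, Unitary.star_mul_self_of_mem (hv i)]
      exact orthonormal_iff_ite.1 he k l
    have h := powers_stormer he hve hs0 (δ := η ^ 2) fun V hV => by
      have h1 := hξv i V hV
      have e1 := hs 1 V
      have e2 := hs (v i) (V * v i)
      simp only [one_apply_eq_self, mul_apply_eq_comp] at e1 e2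
      rwa [e1, e2] at h1
    rw [opTensor_conjOp_diagonalVector, inner_diagonalVector, Complex.ofReal_re]
    rwa [hs1, mul_one] at h
  · simp only [opTensor_conjOp_diagonalVector, mul_apply_eq_comp]
  · have e1 := hs 1 y
    simp only [one_apply_eq_self] at e1
    rw [e1] at hξy
    have h1 := Real.le_sqrt_of_sq_le (norm_sum_inner_sq_le hs0 hs1 e y)
    have h2 := norm_sub_norm_le (φ y) (∑ m, ((s m ^ 2 : ℝ) : ℂ) * ⟪e m, y (e m)⟫_ℂ)
    rw [norm_sub_rev] at h2
    linarith

/-- Under the root, `η` bounds the value of the small convex combination at `z`. Of the three terms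
`‖X‖ * η`, one comes from removing `w` and two from undoing the conjugations. The final `η ^ 2` is
the error in approximating `φ`. -/
theorem norm_map_mul_le (hφ : A.IsCentralState φ) {x : H →L[ℂ] H}
    (hx : (0 : HilbertTensor H (ConjHilbert H) →L[ℂ] HilbertTensor H (ConjHilbert H)) ∈
      closure (convexHull ℝ (A.conjugationOrbit x)))
    {w : H →L[ℂ] H} (hwA : w ∈ A) (hw : w ∈ unitary (H →L[ℂ] H)) {η : ℝ} (hη : 0 < η) :
    ‖φ (x * w)‖ ≤ √(η + 3 * ‖opTensor x (conjOp x)‖ * η) + η ^ 2 := by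
  obtain ⟨T, hT, hTd⟩ :=
    exists_norm_lt_of_zero_mem_closure
      (E := HilbertTensor H (ConjHilbert H) →L[ℂ] HilbertTensor H (ConjHilbert H)) hx hη
  obtain ⟨κ, _, c, t, hc0, hc1, ht, rfl⟩ := mem_convexHull_iff_exists_fintype.1 hT
  choose u huA hu ht using ht
  -- One vector must serve all unitaries at once: `none` indexes `w`, and `some j` indexes the
  -- unitary `u j`.
  obtain ⟨z, hz, hzv, hzmul, hzφ⟩ := hφ.exists_diagonalVector
    (fun i : Option κ => i.elim w u) (by rintro (_ | i); exacts [hwA, huA i])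
    (by rintro (_ | i); exacts [hw, hu i]) (x * w) hη
  set X := opTensor x (conjOp x) with hX
  refine hzφ.trans (add_le_add_left (Real.sqrt_le_sqrt ?_) _)
  have h1 : ‖⟪z, X (opTensor w (conjOp w) z)⟫_ℂ - ⟪z, X z⟫_ℂ‖ ≤ ‖X‖ * η := by
    rw [← inner_sub_right, ← map_sub]
    refine (norm_inner_le_norm _ _).trans ?_
    rw [hz, one_mul]
    exact (X.le_opNorm _).trans (by gcongr; exact (hzv none).1)
  have h2 : ‖⟪z, (∑ j, c j • t j) z⟫_ℂ - ⟪z, X z⟫_ℂ‖ ≤ 2 * ‖X‖ * η := by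
    have e : ⟪z, (∑ j, c j • t j) z⟫_ℂ - ⟪z, X z⟫_ℂ =
        ∑ j, (c j : ℂ) * (⟪z, t j z⟫_ℂ - ⟪z, X z⟫_ℂ) := by
      simp_rw [mul_sub, Finset.sum_sub_distrib, ← Finset.sum_mul, ← Complex.ofReal_sum, hc1,
        Complex.ofReal_one, one_mul, sum_apply, inner_sum, ← Complex.coe_smul, smul_apply,
        inner_smul_right]
    rw [e]
    calc _ ≤ ∑ j, c j * (2 * ‖X‖ * η) := by
          refine (norm_sum_le _ _).trans (Finset.sum_le_sum fun j _ => ?_)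
          rw [norm_mul, Complex.norm_real, Real.norm_of_nonneg (hc0 j)]
          refine mul_le_mul_of_nonneg_left ?_ (hc0 j)
          have hn : ‖u j‖ ≤ 1 := norm_le_one_of_mem_unitary (hu j)
          rw [ht j]
          exact norm_inner_conj_sub_le hz ((norm_opTensor_le _ _).trans
            (mul_le_one₀ hn (norm_nonneg _) ((norm_conjOp_le _).trans hn))) X (hzv (some j)).2
      _ = 2 * ‖X‖ * η := by rw [← Finset.sum_mul, hc1, one_mul]
  have h3 : ‖⟪z, (∑ j, c j • t j) z⟫_ℂ‖ ≤ η := by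
    refine (norm_inner_le_norm _ _).trans ?_
    rw [hz, one_mul]
    exact (ContinuousLinearMap.le_of_opNorm_le _ hTd.le z).trans (by rw [hz, mul_one])
  rw [hzmul]
  calc _ = ‖(⟪z, X (opTensor w (conjOp w) z)⟫_ℂ - ⟪z, X z⟫_ℂ) -
        (⟪z, (∑ j, c j • t j) z⟫_ℂ - ⟪z, X z⟫_ℂ) + ⟪z, (∑ j, c j • t j) z⟫_ℂ‖ := by
        congr 1; ring
    _ ≤ ‖X‖ * η + 2 * ‖X‖ * η + η :=
        norm_add_le_of_le (norm_sub_le_of_le h1 h2) h3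
    _ = η + 3 * ‖X‖ * η := by ring

/-- A central state vanishes on the products of `x` with the elements of the algebra, if the closed
convex hull of the conjugation orbit of `x` contains `0`. -/
theorem map_mul_eq_zero (hφ : A.IsCentralState φ) {x : H →L[ℂ] H}
    (hx : (0 : HilbertTensor H (ConjHilbert H) →L[ℂ] HilbertTensor H (ConjHilbert H)) ∈
      closure (convexHull ℝ (A.conjugationOrbit x)))
    {a : H →L[ℂ] H} (ha : a ∈ A) : φ (x * a) = 0 := by
  have hspan := A.mem_span_unitary ha
  clear ha
  induction hspan using Submodule.span_induction with
  | mem w hw =>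
    rw [← norm_le_zero_iff]
    have hlim : Filter.Tendsto
        (fun η : ℝ => √(η + 3 * ‖opTensor x (conjOp x)‖ * η) + η ^ 2)
        (nhdsWithin 0 (Set.Ioi 0)) (nhds 0) := by
      have : Continuous fun η : ℝ => √(η + 3 * ‖opTensor x (conjOp x)‖ * η) + η ^ 2 := by
        fun_prop
      simpa using (this.tendsto 0).mono_left nhdsWithin_le_nhds
    exact ge_of_tendsto hlim (Filter.eventually_of_mem self_mem_nhdsWithin
      fun η hη => hφ.norm_map_mul_le hx hw.1 hw.2 hη)
  | zero => rw [mul_zero, map_zero]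
  | add a b _ _ iha ihb => rw [mul_add, map_add, iha, ihb, add_zero]
  | smul c a _ ih => rw [mul_smul_comm, map_smul, ih, smul_zero]

end IsCentralState

end VonNeumannAlgebra

theorem mainTheorem2 {H : Type*} [NormedAddCommGroup H] [InnerProductSpace ℂ H] [CompleteSpace H]
    (A : VonNeumannAlgebra H) (hfin : A.IsFinite) (hamen : A.IsAmenable) (x : H →L[ℂ] H)
    (hx : (0 : HilbertTensor H (ConjHilbert H) →L[ℂ] HilbertTensor H (ConjHilbert H)) ∈
      closure (convexHull ℝ (A.conjugationOrbit x)))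
    (φ : (H →L[ℂ] H) →ₚ[ℂ] ℂ) (hφ : A.IsCentralState φ) :
    ∀ a ∈ A, φ (star x * a) = 0 := by
  intro a ha
  -- The argument concerns `x` and not its adjoint, so it is applied to `star a`; hermitianness and
  -- centrality of `φ` then carry the result over.
  have h := hφ.map_mul_eq_zero hx (star_mem ha)
  have e : star x * a = star (star a * x) := by rw [star_mul, star_star]
  rw [e, map_star, hφ.map_mul_comm _ (star_mem ha), h, star_zero]

end
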